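/- Let $X$ be a compact metrizable space and let $T$ be a homomorphism from a countable group $\Gamma$ to the group of homeomorphisms of $X$. Let $\mathrm{Cov}(X)$ be the set of finite open covers of $X$; for $\mathcal U,\mathcal V\in\mathrm{Cov}(X)$ write $\mathcal V\succeq\mathcal U$ if every $V\in\mathcal V$ is contained in some $U\in\mathcal U$. Let $\mathrm{Prob}(X,T)$ be the set of $T$-invariant Borel probability measures on $X$, and define $$\dim(X,T)=\sup_{\mathcal U\in\mathrm{Cov}(X)}\ \inf_{\substack{\mathcal V\in\mathrm{Cov}(X)\\ \mathcal V\succeq\mathcal U}}\ \sup_{\mu\in\mathrm{Prob}(X,T)}\int_X\Big(-1+\sum_{V\in\mathcal V}\mathbf 1_V(x)\Big)\,d\mu(x)\in[-\infty,+\infty],$$ where the supremum over an empty set of measures is $-\infty$. **Theorem.** Let $\Gamma$ be a countable (possibly finite) group and let $d\in\mathbb N=\{0,1,2,\dots\}$. Equip $([0,1]^d)^\Gamma$ with the product topology and the left-shift action $(\mathrm{shift}_\gamma(x))_{\gamma'}=x_{\gamma^{-1}\gamma'}$ of $\Gamma$. Then $$\dim\big(([0,1]^d)^\Gamma,\mathrm{shift}\big)=d.$$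 -/

import Mathlib

open MeasureTheory

noncomputable section

namespace CubicalShift

/-- The order of a finite collection `𝒱` of subsets of `X` at the point `x`:
`-1 + ∑_{V ∈ 𝒱} 1_V(x)`. -/
def ordAt {X : Type*} (𝒱 : Finset (Set X)) (x : X) : ℝ :=
  -1 + ∑ V ∈ 𝒱, V.indicator (fun _ => (1 : ℝ)) x

/-- `𝒱` is a finite open cover of `X`. -/
def IsOpenCover {X : Type*} [TopologicalSpace X] (𝒱 : Finset (Set X)) : Prop :=
  (∀ V ∈ 𝒱, IsOpen V) ∧ ∀ x : X, ∃ V ∈ 𝒱, x ∈ V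

/-- `𝒱` refines `𝒰`: each member of `𝒱` is contained in some member of `𝒰`. -/
def Refines {X : Type*} (𝒱 𝒰 : Finset (Set X)) : Prop :=
  ∀ V ∈ 𝒱, ∃ U ∈ 𝒰, V ⊆ U

section Pair

variable {X : Type*} [TopologicalSpace X] [MeasurableSpace X] [BorelSpace X]

/-- `ord(𝒱, P) = sup_{μ ∈ P} ∫ ord(𝒱, x) dμ(x)`, as an extended real; it is `-∞` for `P = ∅`.
The integrand is bounded, and Borel when the members of `𝒱` are. -/
def ordPair (𝒱 : Finset (Set X)) (P : Set (ProbabilityMeasure X)) : EReal :=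
  ⨆ μ ∈ P, ((∫ x, ordAt 𝒱 x ∂(μ : Measure X) : ℝ) : EReal)

/-- `dim(𝒰, P)`: the infimum of `ord(𝒱, P)` over the finite open covers `𝒱` refining `𝒰`. -/
def dimCover (𝒰 : Finset (Set X)) (P : Set (ProbabilityMeasure X)) : EReal :=
  ⨅ 𝒱 : Finset (Set X), ⨅ _ : IsOpenCover 𝒱 ∧ Refines 𝒱 𝒰, ordPair 𝒱 P

variable (X) in
/-- `dim(X, P)`: the supremum of `dim(𝒰, P)` over the finite open covers `𝒰` of `X`.
For `P = ∅` this is `-∞`. -/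
def dimPair (P : Set (ProbabilityMeasure X)) : EReal :=
  ⨆ 𝒰 : Finset (Set X), ⨆ _ : IsOpenCover 𝒰, dimCover 𝒰 P

/-- The Borel probability measures on `X` invariant under the action `T` of `Γ` on `X` by
homeomorphisms. -/
def invariantProb {Γ : Type*} [Group Γ] (T : Γ →* (X ≃ₜ X)) : Set (ProbabilityMeasure X) :=
  {μ | ∀ γ : Γ, (μ : Measure X).map (T γ) = (μ : Measure X)}

/-- The dimension `dim(X, T)` of the dynamical system `(X, T)`. -/
def dimSystem {Γ : Type*} [Group Γ] (T : Γ →* (X ≃ₜ X)) : EReal :=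
  dimPair X (invariantProb T)

end Pair

/-- The left shift action of `Γ` on `K^Γ` (with the product topology):
`(shift γ x) γ' = x (γ⁻¹ * γ')`. -/
def shift (Γ : Type*) [Group Γ] (K : Type*) [TopologicalSpace K] :
    Γ →* ((Γ → K) ≃ₜ (Γ → K)) where
  toFun γ :=
    { toFun := fun x γ' => x (γ⁻¹ * γ')
      invFun := fun x γ' => x (γ * γ')
      left_inv := fun x => by funext γ'; simp
      right_inv := fun x => by funext γ'; simp
      continuous_toFun := by fun_prop
      continuous_invFun := by fun_prop }
  map_one' := by ext x γ'; simp
  map_mul' γ₁ γ₂ := by ext x γ'; simp [mul_assoc]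

end CubicalShift

end

namespace CubicalShift

section Cochains

/-- The mod `2` simplicial coboundary; a simplex is the list of its vertices. -/
def coboundary {V : Type*} : (List V → ZMod 2) → List V → ZMod 2
  | _, [] => 0
  | ω, v :: L => ω L + coboundary (fun l => ω (v :: l)) L

/-- The pullback of a cochain along the prism operator between the vertex maps `a` and `b`. -/
def prism {V W : Type*} (a b : V → W) : (List W → ZMod 2) → List V → ZMod 2
  | _, [] => 0
  | ω, v :: L => ω (a v :: b v :: L.map b) + prism a b (fun l => ω (a v :: l)) L

variable {V W : Type*}

theorem coboundary_add (ω θ : List V → ZMod 2) (L : List V) :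
    coboundary (fun l => ω l + θ l) L = coboundary ω L + coboundary θ L := by
  induction L generalizing ω θ with
  | nil => simp [coboundary]
  | cons v L ih => simp only [coboundary, ih]; ring

theorem coboundary_mul (c : ZMod 2) (ω : List V → ZMod 2) (L : List V) :
    coboundary (fun l => c * ω l) L = c * coboundary ω L := by
  induction L generalizing ω with
  | nil => simp [coboundary]
  | cons v L ih => simp only [coboundary, ih]; ring

theorem coboundary_sum {ι : Type*} (s : Finset ι) (ω : ι → List V → ZMod 2) (L : List V) :
    coboundary (fun l => ∑ i ∈ s, ω i l) L = ∑ i ∈ s, coboundary (ω i) L := by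
  induction L generalizing ω with
  | nil => simp [coboundary]
  | cons v L ih => simp only [coboundary, ih, Finset.sum_add_distrib]

theorem coboundary_map (b : V → W) (ω : List W → ZMod 2) (L : List V) :
    coboundary (fun l => ω (l.map b)) L = coboundary ω (L.map b) := by
  induction L generalizing ω with
  | nil => simp [coboundary]
  | cons v L ih =>
    simp only [coboundary, List.map_cons]
    rw [ih (fun l => ω (b v :: l))]

theorem coboundary_coboundary (ω : List V → ZMod 2) (L : List V) :
    coboundary (coboundary ω) L = 0 := by
  induction L generalizing ω with
  | nil => simp [coboundary]
  | cons v L ih =>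
    simp only [coboundary]
    rw [coboundary_add ω, ih, add_zero, CharTwo.add_self_eq_zero]

theorem prism_add (a b : V → W) (ω θ : List W → ZMod 2) (L : List V) :
    prism a b (fun l => ω l + θ l) L = prism a b ω L + prism a b θ L := by
  induction L generalizing ω θ with
  | nil => simp [prism]
  | cons v L ih => simp only [prism, ih]; ring

/-- The prism operator is a chain homotopy between the maps induced by `a` and `b`. -/
theorem prism_coboundary (a b : V → W) (ω : List W → ZMod 2) (L : List V) :
    prism a b (coboundary ω) L =
      coboundary (prism a b ω) L + ω (L.map b) + ω (L.map a) := by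
  induction L generalizing ω with
  | nil => simp [prism, coboundary, CharTwo.add_self_eq_zero]
  | cons v L ih =>
    simp only [prism, coboundary, List.map_cons]
    rw [prism_add a b ω, ih,
      coboundary_add (fun l => ω (a v :: b v :: l.map b)),
      coboundary_map b (fun l => ω (a v :: b v :: l))]
    linear_combination CharTwo.add_self_eq_zero (ω (a v :: L.map b))

theorem exists_of_prism_ne_zero {a b : V → W} {ω : List W → ZMod 2} {L : List V}
    (h : prism a b ω L ≠ 0) :
    ∃ L', ω L' ≠ 0 ∧ ∀ w ∈ L', ∃ v ∈ L, w = a v ∨ w = b v := by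
  induction L generalizing ω with
  | nil => simp [prism] at h
  | cons v L ih =>
    by_cases h0 : ω (a v :: b v :: L.map b) = 0
    · simp only [prism, h0, zero_add] at h
      obtain ⟨L', h1, h2⟩ := ih h
      refine ⟨a v :: L', h1, ?_⟩
      simp only [List.mem_cons]
      rintro w (rfl | hw)
      · exact ⟨v, Or.inl rfl, Or.inl rfl⟩
      · obtain ⟨u, hu, h⟩ := h2 w hw
        exact ⟨u, Or.inr hu, h⟩
    · refine ⟨_, h0, ?_⟩
      simp only [List.mem_cons, List.mem_map]
      rintro w (rfl | rfl | ⟨u, hu, rfl⟩)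
      · exact ⟨v, Or.inl rfl, Or.inl rfl⟩
      · exact ⟨v, Or.inl rfl, Or.inr rfl⟩
      · exact ⟨u, Or.inr hu, Or.inr rfl⟩

/-- The cup product of a `0`-cochain with a cochain. -/
def cupZero (g : V → ZMod 2) (θ : List V → ZMod 2) : List V → ZMod 2
  | [] => 0
  | v :: L => g v * θ (v :: L)

/-- The cup product `δf_{k-1} ∪ ⋯ ∪ δf_0`. -/
def cupCoboundaries (f : ℕ → V → ZMod 2) : ℕ → List V → ZMod 2
  | 0 => fun L => if L.length = 1 then 1 else 0
  | k + 1 => coboundary (cupZero (f k) (cupCoboundaries f k))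

theorem cupCoboundaries_nil (f : ℕ → V → ZMod 2) (k : ℕ) : cupCoboundaries f k [] = 0 := by
  cases k <;> simp [cupCoboundaries, coboundary]

theorem coboundary_cupCoboundaries (f : ℕ → V → ZMod 2) (k : ℕ) (L : List V) :
    coboundary (cupCoboundaries f k) L = 0 := by
  cases k with
  | zero =>
    match L with
    | [] => rfl
    | [v] => simp [cupCoboundaries, coboundary]
    | [v, w] => simp [cupCoboundaries, coboundary, CharTwo.add_self_eq_zero]
    | u :: v :: w :: L =>
      have h : ∀ (L : List V), coboundary (fun _ => 0) L = 0 := fun L => by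
        simpa using coboundary_mul 0 (fun _ => 0) L
      simp [cupCoboundaries, coboundary, h]
  | succ k => exact coboundary_coboundary _ _

theorem coboundary_cupZero (g : V → ZMod 2) (θ : List V → ZMod 2)
    (hθ : ∀ L, coboundary θ L = 0) (v : V) (L : List V) :
    coboundary (cupZero g θ) (v :: L) = cupZero g θ L + g v * θ L := by
  have h := hθ (v :: L)
  simp only [coboundary] at h ⊢
  have h1 : (fun l => cupZero g θ (v :: l)) = fun l => g v * θ (v :: l) := rfl
  rw [h1, coboundary_mul, ← CharTwo.add_eq_zero.1 h]

theorem cupCoboundaries_succ_cons_cons (f : ℕ → V → ZMod 2) (k : ℕ) (v w : V) (L : List V) :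
    cupCoboundaries f (k + 1) (v :: w :: L) = (f k v + f k w) * cupCoboundaries f k (w :: L) := by
  rw [cupCoboundaries, coboundary_cupZero _ _ (coboundary_cupCoboundaries f k), cupZero]
  ring

theorem cupCoboundaries_succ_singleton (f : ℕ → V → ZMod 2) (k : ℕ) (v : V) :
    cupCoboundaries f (k + 1) [v] = 0 := by
  rw [cupCoboundaries, coboundary_cupZero _ _ (coboundary_cupCoboundaries f k), cupZero,
    cupCoboundaries_nil]
  ring

theorem cupZero_map (b : V → W) (g : W → ZMod 2) (θ : List W → ZMod 2) (L : List V) :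
    cupZero g θ (L.map b) = cupZero (g ∘ b) (fun l => θ (l.map b)) L := by
  cases L <;> simp [cupZero]

theorem cupCoboundaries_map (b : V → W) (f : ℕ → W → ZMod 2) (k : ℕ) (L : List V) :
    cupCoboundaries f k (L.map b) = cupCoboundaries (fun j => f j ∘ b) k L := by
  induction k generalizing L with
  | zero => simp [cupCoboundaries]
  | succ k ih =>
    simp only [cupCoboundaries]
    rw [← coboundary_map]
    congr 1
    funext l
    rw [cupZero_map]
    congr 1
    funext l
    exact ih l

theorem exists_ne_of_cupCoboundaries_ne_zero {f : ℕ → V → ZMod 2} {k : ℕ} {L : List V}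
    (h : cupCoboundaries f k L ≠ 0) {j : ℕ} (hj : j < k) :
    ∃ v ∈ L, ∃ w ∈ L, f j v ≠ f j w := by
  induction k generalizing L with
  | zero => omega
  | succ k ih =>
    match L with
    | [] => exact absurd (cupCoboundaries_nil f _) h
    | [v] => exact absurd (cupCoboundaries_succ_singleton f k v) h
    | v :: w :: L =>
      rw [cupCoboundaries_succ_cons_cons] at h
      rcases Nat.lt_succ_iff_lt_or_eq.1 hj with hj | rfl
      · obtain ⟨x, hx, y, hy, hxy⟩ := ih (right_ne_zero_of_mul h) hj
        exact ⟨x, List.mem_cons_of_mem _ hx, y, List.mem_cons_of_mem _ hy, hxy⟩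
      · refine ⟨v, by simp, w, by simp, fun hvw => left_ne_zero_of_mul h ?_⟩
        rw [hvw, CharTwo.add_self_eq_zero]

end Cochains

section Grid

/-- Integration of a cochain over the interval `{0, …, n}` in the coordinate `d`. -/
def fiberIntegral (n d : ℕ) (ω : List (ℕ → ℕ) → ZMod 2) (L : List (ℕ → ℕ)) : ZMod 2 :=
  ∑ m ∈ Finset.range n,
    prism (fun v => Function.update v d m) (fun v => Function.update v d (m + 1)) ω L

/-- Integration of a cochain over the grid `{0, …, n} ^ d`, in its standard triangulation. -/
def gridIntegral (n : ℕ) : ℕ → (List (ℕ → ℕ) → ZMod 2) → ZMod 2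
  | 0, ω => ω [0]
  | d + 1, ω => gridIntegral n d (fiberIntegral n d ω)

variable {n : ℕ}

theorem gridIntegral_add (d : ℕ) (ω θ : List (ℕ → ℕ) → ZMod 2) :
    gridIntegral n d (fun l => ω l + θ l) = gridIntegral n d ω + gridIntegral n d θ := by
  induction d generalizing ω θ with
  | zero => rfl
  | succ d ih =>
    simp only [gridIntegral]
    rw [← ih]
    congr 1
    funext l
    simp only [fiberIntegral, prism_add, Finset.sum_add_distrib]

theorem fiberIntegral_coboundary (d : ℕ) (ω : List (ℕ → ℕ) → ZMod 2) (L : List (ℕ → ℕ)) :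
    fiberIntegral n d (coboundary ω) L = coboundary (fiberIntegral n d ω) L +
      (ω (L.map fun v => Function.update v d n) + ω (L.map fun v => Function.update v d 0)) := by
  unfold fiberIntegral
  rw [coboundary_sum]
  induction n with
  | zero => simp [CharTwo.add_self_eq_zero]
  | succ n ih =>
    rw [Finset.sum_range_succ, ih, Finset.sum_range_succ, prism_coboundary]
    linear_combination
      CharTwo.add_self_eq_zero (ω (L.map fun v => Function.update v d n))

theorem exists_of_gridIntegral_ne_zero {d : ℕ} {ω : List (ℕ → ℕ) → ZMod 2}
    (h : gridIntegral n d ω ≠ 0) :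
    ∃ (b : ℕ → ℕ) (L : List (ℕ → ℕ)), ω L ≠ 0 ∧ (∀ k < d, b k < n) ∧
      ∀ v ∈ L, ∀ k < d, b k ≤ v k ∧ v k ≤ b k + 1 := by
  induction d generalizing ω with
  | zero => exact ⟨0, [0], h, by simp, by simp⟩
  | succ d ih =>
    obtain ⟨b, L, hL, hb, hv⟩ := ih h
    obtain ⟨m, hm, hmL⟩ := Finset.exists_ne_zero_of_sum_ne_zero hL
    obtain ⟨L', hL', hw⟩ := exists_of_prism_ne_zero hmL
    refine ⟨Function.update b d m, L', hL', ?_, ?_⟩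
    · intro k hk
      rcases Nat.lt_succ_iff_lt_or_eq.1 hk with hk | rfl
      · rw [Function.update_of_ne hk.ne]; exact hb k hk
      · simpa using hm
    · intro w hwL k hk
      obtain ⟨v, hvL, h⟩ := hw w hwL
      rcases Nat.lt_succ_iff_lt_or_eq.1 hk with hk | rfl
      · have := hv v hvL k hk
        rcases h with rfl | rfl <;> simpa [Function.update_of_ne hk.ne] using this
      · rcases h with rfl | rfl <;> simp

/-- A cochain on the grid `{0, …, n} ^ d` vanishing on the faces of the grid. -/
def VanishesOnFaces (n d : ℕ) (θ : List (ℕ → ℕ) → ZMod 2) : Prop :=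
  θ [] = 0 ∧ ∀ k < d, ∀ c, c = 0 ∨ c = n → ∀ L, (∀ v ∈ L, v k = c) → θ L = 0

theorem VanishesOnFaces.fiberIntegral {d : ℕ} {θ : List (ℕ → ℕ) → ZMod 2}
    (h : ∀ k < d, ∀ c, c = 0 ∨ c = n → ∀ L, (∀ v ∈ L, v k = c) → θ L = 0) :
    VanishesOnFaces n d (fiberIntegral n d θ) := by
  refine ⟨by simp [CubicalShift.fiberIntegral, prism], fun k hk c hc L hL => ?_⟩
  refine Finset.sum_eq_zero fun m _ => ?_
  by_contra h0
  obtain ⟨L', hL', hw⟩ := exists_of_prism_ne_zero h0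
  refine hL' (h k hk c hc L' fun w hwL => ?_)
  obtain ⟨v, hv, rfl | rfl⟩ := hw w hwL <;> simpa [Function.update_of_ne hk.ne] using hL v hv

/-- Stokes' theorem on the grid, for cochains vanishing on the boundary. -/
theorem gridIntegral_coboundary {d : ℕ} {θ : List (ℕ → ℕ) → ZMod 2}
    (h : VanishesOnFaces n d θ) : gridIntegral n d (coboundary θ) = 0 := by
  induction d generalizing θ with
  | zero => simpa [gridIntegral, coboundary] using h.1
  | succ d ih =>
    have h1 : fiberIntegral n d (coboundary θ) = coboundary (fiberIntegral n d θ) := by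
      funext L
      rw [fiberIntegral_coboundary, h.2 d d.lt_succ_self n (Or.inr rfl),
        h.2 d d.lt_succ_self 0 (Or.inl rfl)]
      · simp
      · simp
      · simp
    rw [gridIntegral, h1]
    exact ih (.fiberIntegral fun k hk => h.2 k (hk.trans d.lt_succ_self))

theorem gridIntegral_cupCoboundaries {d : ℕ} {f : ℕ → (ℕ → ℕ) → ZMod 2}
    (h0 : ∀ k < d, ∀ v, v k = 0 → f k v = 0) (h1 : ∀ k < d, ∀ v, v k = n → f k v = 1) :
    gridIntegral n d (cupCoboundaries f d) = 1 := by
  induction d generalizing f with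
  | zero => simp [gridIntegral, cupCoboundaries]
  | succ d ih =>
    have hface : ∀ k < d, ∀ c, c = 0 ∨ c = n → ∀ L, (∀ v ∈ L, v k = c) →
        cupZero (f d) (cupCoboundaries f d) L = 0 := by
      intro k hk c hc L hL
      cases L with
      | nil => rfl
      | cons v L =>
        rw [cupZero]
        by_contra hne
        obtain ⟨x, hx, y, hy, hxy⟩ :=
          exists_ne_of_cupCoboundaries_ne_zero (right_ne_zero_of_mul hne) hk
        apply hxy
        have hkd := hk.trans d.lt_succ_self
        rcases hc with rfl | rfl
        · rw [h0 k hkd x (hL x hx), h0 k hkd y (hL y hy)]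
        · rw [h1 k hkd x (hL x hx), h1 k hkd y (hL y hy)]
    have hstep : fiberIntegral n d (cupCoboundaries f (d + 1)) = fun L =>
        coboundary (fiberIntegral n d (cupZero (f d) (cupCoboundaries f d))) L +
          cupCoboundaries (fun j => f j ∘ fun v => Function.update v d n) d L := by
      funext L
      rw [cupCoboundaries, fiberIntegral_coboundary, cupZero_map, cupZero_map]
      congr 1
      cases L with
      | nil => simp [cupZero, cupCoboundaries_nil]
      | cons v L =>
        rw [cupZero, cupZero, cupCoboundaries_map]
        simp [h0 d d.lt_succ_self, h1 d d.lt_succ_self]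
    rw [gridIntegral, hstep, gridIntegral_add, gridIntegral_coboundary (.fiberIntegral hface),
      zero_add]
    apply ih
    · intro k hk v hv
      exact h0 k (hk.trans d.lt_succ_self) _ (by simpa [Function.update_of_ne hk.ne] using hv)
    · intro k hk v hv
      exact h1 k (hk.trans d.lt_succ_self) _ (by simpa [Function.update_of_ne hk.ne] using hv)

/-- A discrete Poincaré–Miranda theorem: some unit cell of the grid `{0, …, n} ^ d` has, for each
`k < d`, two points at which `f k` differs. -/
theorem exists_cell_forall_ne {d : ℕ} {f : ℕ → (ℕ → ℕ) → ZMod 2}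
    (h0 : ∀ k < d, ∀ v, v k = 0 → f k v = 0) (h1 : ∀ k < d, ∀ v, v k = n → f k v = 1) :
    ∃ b : ℕ → ℕ, (∀ k < d, b k < n) ∧ ∀ k < d, ∃ v w : ℕ → ℕ,
      (∀ j < d, b j ≤ v j ∧ v j ≤ b j + 1) ∧ (∀ j < d, b j ≤ w j ∧ w j ≤ b j + 1) ∧
        f k v ≠ f k w := by
  obtain ⟨b, L, hL, hb, hv⟩ := exists_of_gridIntegral_ne_zero (n := n) (d := d)
    (ω := cupCoboundaries f d) (by rw [gridIntegral_cupCoboundaries h0 h1]; exact one_ne_zero)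
  refine ⟨b, hb, fun k hk => ?_⟩
  obtain ⟨v, hvL, w, hwL, h⟩ := exists_ne_of_cupCoboundaries_ne_zero hL hk
  exact ⟨v, w, hv v hvL, hv w hwL, h⟩

end Grid

section Cube

/-- The point of the cube with coordinates `v j / n`. -/
noncomputable def gridPoint (d n : ℕ) (v : ℕ → ℕ) : Fin d → unitInterval :=
  fun j => Set.projIcc (0 : ℝ) 1 zero_le_one ((v j : ℝ) / n)

theorem dist_gridPoint_le {d n : ℕ} {b v : ℕ → ℕ}
    (h : ∀ j < d, b j ≤ v j ∧ v j ≤ b j + 1) :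
    dist (gridPoint d n b) (gridPoint d n v) ≤ 1 / n := by
  refine (dist_pi_le_iff (by positivity)).2 fun j => ?_
  obtain ⟨h1, h2⟩ := h j j.2
  rw [Subtype.dist_eq, Real.dist_eq]
  refine (Set.abs_projIcc_sub_projIcc zero_le_one).trans ?_
  rw [← sub_div, abs_div, Nat.abs_cast]
  gcongr
  have h1' : (b j : ℝ) ≤ v j := by exact_mod_cast h1
  have h2' : (v j : ℝ) ≤ b j + 1 := by exact_mod_cast h2
  rw [abs_le]
  constructor <;> linarith

/-- The Poincaré–Miranda theorem. -/
theorem exists_forall_eq_zero_of_faces {d : ℕ} (h : Fin d → (Fin d → unitInterval) → ℝ)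
    (hc : ∀ j, Continuous (h j)) (h0 : ∀ j x, x j = 0 → h j x ≤ 0)
    (h1 : ∀ j x, x j = 1 → 0 ≤ h j x) : ∃ x, ∀ j, h j x = 0 := by
  classical
  by_contra! hne
  obtain ⟨x₀, -, hx₀⟩ := isCompact_univ.exists_isMinOn Set.univ_nonempty
    (continuous_finsetSum Finset.univ fun j _ => (hc j).abs).continuousOn
  have hpos : 0 < ∑ j, |h j x₀| := by
    obtain ⟨j, hj⟩ := hne x₀
    exact Finset.sum_pos' (fun _ _ => abs_nonneg _) ⟨j, Finset.mem_univ _, abs_pos.2 hj⟩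
  set ε := (∑ j, |h j x₀|) / (d + 1) with hε
  have hεpos : 0 < ε := by positivity
  have hu := CompactSpace.uniformContinuous_of_continuous (continuous_pi hc)
  obtain ⟨δ, hδ, hδh⟩ := Metric.uniformContinuous_iff.1 hu ε hεpos
  obtain ⟨N, hN⟩ := exists_nat_one_div_lt hδ
  set n := N + 1 with hn
  have hnδ : (1 : ℝ) / n < δ := by rw [hn]; exact_mod_cast hN
  let f : ℕ → (ℕ → ℕ) → ZMod 2 := fun k v =>
    if v k = n then 1 else if v k = 0 then 0 else
      if ∃ hk : k < d, 0 < h ⟨k, hk⟩ (gridPoint d n v) then 1 else 0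
  have hf1 : ∀ k (hk : k < d) v, f k v = 1 → 0 ≤ h ⟨k, hk⟩ (gridPoint d n v) := by
    intro k hk v hv
    by_cases hvn : v k = n
    · refine h1 _ _ ?_
      simp only [gridPoint, hvn]
      rw [div_self (by rw [hn]; positivity), Set.projIcc_right]
      rfl
    · by_cases hv0 : v k = 0
      · simp [f, hv0, hn] at hv
      · by_cases hh : ∃ hk : k < d, 0 < h ⟨k, hk⟩ (gridPoint d n v)
        · exact hh.2.le
        · simp only [f, if_neg hvn, if_neg hv0, if_neg hh] at hv
          exact absurd hv zero_ne_one
  have hf0 : ∀ k (hk : k < d) v, f k v ≠ 1 → h ⟨k, hk⟩ (gridPoint d n v) ≤ 0 := by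
    intro k hk v hv
    by_cases hvn : v k = n
    · simp [f, hvn] at hv
    · by_cases hv0 : v k = 0
      · refine h0 _ _ ?_
        simp only [gridPoint, hv0]
        rw [Nat.cast_zero, zero_div, Set.projIcc_left]
        rfl
      · by_cases hh : ∃ hk : k < d, 0 < h ⟨k, hk⟩ (gridPoint d n v)
        · simp only [f, if_neg hvn, if_neg hv0, if_pos hh] at hv
          exact absurd rfl hv
        · by_contra hlt
          exact hh ⟨hk, not_le.1 hlt⟩
  obtain ⟨b, -, hb⟩ := exists_cell_forall_ne (n := n) (d := d) (f := f)
    (fun k _ v hv => by simp [f, hv, hn]) (fun k _ v hv => by simp [f, hv])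
  have hclose : ∀ (j : Fin d) (v : ℕ → ℕ), (∀ j < d, b j ≤ v j ∧ v j ≤ b j + 1) →
      |h j (gridPoint d n b) - h j (gridPoint d n v)| < ε := by
    intro j v hv
    have := hδh ((dist_gridPoint_le (n := n) hv).trans_lt hnδ)
    rw [← Real.dist_eq]
    exact (dist_le_pi_dist (fun j => h j (gridPoint d n b)) (fun j => h j (gridPoint d n v))
      j).trans_lt this
  have hsmall : ∀ j : Fin d, |h j (gridPoint d n b)| ≤ ε := by
    intro j
    obtain ⟨v, w, hv, hw, hvw⟩ := hb j j.2
    wlog hv1 : f j v = 1 generalizing v w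
    · refine this w v hw hv hvw.symm ?_
      have : ∀ a c : ZMod 2, a ≠ c → ¬ a = 1 → c = 1 := by decide
      exact this _ _ hvw hv1
    have e1 := hf1 j j.2 v hv1
    have e2 := hf0 j j.2 w (fun h => hvw (hv1.trans h.symm))
    have e3 := abs_lt.1 (hclose j v hv)
    have e4 := abs_lt.1 (hclose j w hw)
    simp only [Fin.eta] at e1 e2
    rw [abs_le]
    constructor <;> linarith [e3.1, e4.2]
  have hmin : ∑ j, |h j x₀| ≤ ∑ j, |h j (gridPoint d n b)| := hx₀ (Set.mem_univ _)
  have hle : ∑ j, |h j (gridPoint d n b)| ≤ d * ε := by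
    simpa using Finset.sum_le_sum fun j (_ : j ∈ Finset.univ) => hsmall j
  have hεeq : (d + 1) * ε = ∑ j, |h j x₀| := by rw [hε]; field_simp
  linarith

/-- The Lebesgue covering theorem: if no member of a finite open cover of the cube `[0,1] ^ d` meets
two opposite faces, some point lies in at least `d + 1` members. -/
theorem exists_card_le_of_openCover {ι : Type*} {d : ℕ} (s : Finset ι)
    (V : ι → Set (Fin d → unitInterval)) (hV : ∀ i ∈ s, IsOpen (V i))
    (hcov : ∀ x, ∃ i ∈ s, x ∈ V i)
    (hface : ∀ i ∈ s, ∀ j, (∀ x ∈ V i, x j ≠ 0) ∨ ∀ x ∈ V i, x j ≠ 1)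
    [∀ x, DecidablePred fun i => x ∈ V i] :
    ∃ x, d + 1 ≤ (s.filter fun i => x ∈ V i).card := by
  classical
  rcases Nat.eq_zero_or_pos d with rfl | hd
  · obtain ⟨i, hi, hx⟩ := hcov 0
    exact ⟨0, Finset.card_pos.2 ⟨i, Finset.mem_filter.2 ⟨hi, hx⟩⟩⟩
  have hex : ∀ i, ∃ k, ∀ hk : k < d, ∀ x ∈ V i, x ⟨k, hk⟩ ≠ 0 :=
    fun i => ⟨d, fun h => absurd h (lt_irrefl _)⟩
  let c : ι → ℕ := fun i => Nat.find (hex i)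
  have hcd : ∀ i, c i ≤ d := fun i => Nat.find_min' _ fun h => absurd h (lt_irrefl _)
  have hc0 : ∀ i (hk : c i < d), ∀ x ∈ V i, x ⟨c i, hk⟩ ≠ 0 := fun i => Nat.find_spec (hex i)
  have hc1 : ∀ i ∈ s, ∀ k (hk : k < d), k < c i → ∀ x ∈ V i, x ⟨k, hk⟩ ≠ 1 := by
    intro i hi k hk hki
    refine (hface i hi ⟨k, hk⟩).resolve_left fun h => ?_
    exact Nat.find_min (hex i) hki fun _ => h
  let C : ℕ → Set (Fin d → unitInterval) := fun k => ⋃ i ∈ s, ⋃ _ : c i = k, V i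
  have hCmem : ∀ k x, x ∈ C k ↔ ∃ i ∈ s, c i = k ∧ x ∈ V i := by
    intro k x
    simp only [C, Set.mem_iUnion, exists_prop]
  have hCopen : ∀ k, IsOpen (C k) := fun k =>
    isOpen_biUnion fun i hi => isOpen_iUnion fun _ => hV i hi
  have hC0 : ∀ k (hk : k < d) x, x ⟨k, hk⟩ = 0 → x ∉ C k := by
    intro k hk x hx hxC
    obtain ⟨i, hi, rfl, hxi⟩ := (hCmem _ _).1 hxC
    exact hc0 i hk x hxi hx
  have hC1 : ∀ k (hk : k < d) x, x ⟨k, hk⟩ = 1 → x ∉ C (k + 1) := by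
    intro k hk x hx hxC
    obtain ⟨i, hi, hik, hxi⟩ := (hCmem _ _).1 hxC
    exact hc1 i hi k hk (by omega) x hxi hx
  have hne : ∀ k ≤ d, (C k)ᶜ.Nonempty := by
    intro k hk
    rcases hk.lt_or_eq with hk | rfl
    · exact ⟨0, hC0 k hk 0 rfl⟩
    · obtain ⟨m, rfl⟩ := Nat.exists_eq_succ_of_ne_zero hd.ne'
      exact ⟨1, hC1 m m.lt_succ_self 1 rfl⟩
  let g : ℕ → (Fin d → unitInterval) → ℝ := fun k x => Metric.infDist x (C k)ᶜ
  have hg0 : ∀ k x, x ∉ C k → g k x = 0 := fun k x hx => Metric.infDist_zero_of_mem hx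
  have hgpos : ∀ k ≤ d, ∀ x, 0 < g k x ↔ x ∈ C k := by
    intro k hk x
    simp only [g]
    rw [← Metric.infDist_pos_iff_notMem_closure (hne k hk), (hCopen k).isClosed_compl.closure_eq,
      Set.notMem_compl_iff]
  obtain ⟨x, hx⟩ := exists_forall_eq_zero_of_faces
    (fun (j : Fin d) x => g j x - g (j + 1) x)
    (fun j => (Metric.continuous_infDist_pt _).sub (Metric.continuous_infDist_pt _))
    (fun j x hxj => by
      rw [hg0 j x (hC0 j j.2 x hxj), zero_sub]
      exact neg_nonpos.2 Metric.infDist_nonneg)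
    (fun j x hxj => by
      rw [hg0 (j + 1) x (hC1 j j.2 x hxj), sub_zero]
      exact Metric.infDist_nonneg)
  have heq : ∀ k ≤ d, g k x = g 0 x := by
    intro k
    induction k with
    | zero => simp
    | succ k ih =>
      intro hk
      rw [← ih (by omega), ← sub_eq_zero.1 (hx ⟨k, by omega⟩)]
  have hall : ∀ k ≤ d, x ∈ C k := by
    obtain ⟨i, hi, hxi⟩ := hcov x
    have h0 : 0 < g (c i) x := (hgpos _ (hcd i) x).2 ((hCmem _ _).2 ⟨i, hi, rfl, hxi⟩)
    intro k hk
    rw [← hgpos k hk, heq k hk, ← heq _ (hcd i)]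
    exact h0
  refine ⟨x, ?_⟩
  calc d + 1 = (Finset.range (d + 1)).card := (Finset.card_range _).symm
    _ ≤ ((s.filter fun i => x ∈ V i).image c).card := by
      refine Finset.card_le_card fun k hk => ?_
      obtain ⟨i, hi, hik, hxi⟩ := (hCmem _ _).1 (hall k (Nat.lt_succ_iff.1 (Finset.mem_range.1 hk)))
      exact Finset.mem_image.2 ⟨i, Finset.mem_filter.2 ⟨hi, hxi⟩, hik⟩
    _ ≤ _ := Finset.card_image_le

end Cube

theorem ordAt_eq_card {X : Type*} (𝒱 : Finset (Set X)) (x : X)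
    [DecidablePred fun V : Set X => x ∈ V] :
    ordAt 𝒱 x = -1 + ((𝒱.filter fun V => x ∈ V).card : ℝ) := by
  classical
  rw [ordAt, Finset.card_filter]
  push_cast
  congr 1
  refine Finset.sum_congr rfl fun V _ => ?_
  by_cases h : x ∈ V <;> simp [h]

section LowerBound

variable (Γ : Type*) [Group Γ] (d : ℕ)

/-- The cover of the space of configurations by the sets where each coordinate of `x 1` avoids a
prescribed endpoint of the interval. -/
noncomputable def endpointCover : Finset (Set (Γ → Fin d → unitInterval)) :=
  open Classical in
  Finset.univ.image fun σ : Fin d → Bool =>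
    {x | ∀ j, x 1 j ≠ if σ j then (0 : unitInterval) else 1}

theorem isOpenCover_endpointCover : IsOpenCover (endpointCover Γ d) := by
  classical
  refine ⟨?_, fun x => ?_⟩
  · simp only [endpointCover, Finset.mem_image]
    rintro _ ⟨σ, -, rfl⟩
    simp only [Set.ofPred_forall]
    exact isOpen_iInter_of_finite fun j => isOpen_ne_fun (by fun_prop) continuous_const
  · refine ⟨_, Finset.mem_image_of_mem _ (Finset.mem_univ fun j => decide (x 1 j ≠ 0)), ?_⟩
    intro j
    by_cases h : x 1 j = 0 <;> simp [h]

theorem dirac_const_mem_invariantProb [Countable Γ] (y : Fin d → unitInterval) :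
    (⟨Measure.dirac fun _ => y, inferInstance⟩ :
      ProbabilityMeasure (Γ → Fin d → unitInterval)) ∈
        invariantProb (shift Γ (Fin d → unitInterval)) := by
  intro γ
  have hm : Measurable (shift Γ (Fin d → unitInterval) γ) :=
    (shift Γ (Fin d → unitInterval) γ).continuous.measurable
  exact Measure.map_dirac' hm _

theorem le_dimSystem_shift [Countable Γ] :
    (d : EReal) ≤ dimSystem (shift Γ (Fin d → unitInterval)) := by
  classical
  refine le_iSup₂_of_le (endpointCover Γ d) (isOpenCover_endpointCover Γ d) ?_
  refine le_iInf₂ fun 𝒱 h𝒱 => ?_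
  obtain ⟨⟨hopen, hcov⟩, href⟩ := h𝒱
  obtain ⟨y, hy⟩ := exists_card_le_of_openCover 𝒱
    (fun V => {y : Fin d → unitInterval | (fun _ : Γ => y) ∈ V})
    (fun V hV => (hopen V hV).preimage (by fun_prop)) (fun y => hcov fun _ => y)
    (fun V hV j => by
      obtain ⟨U, hU, hVU⟩ := href V hV
      simp only [endpointCover, Finset.mem_image] at hU
      obtain ⟨σ, -, rfl⟩ := hU
      cases hσ : σ j
      · right
        intro y hy
        simpa [hσ] using hVU hy j
      · left
        intro y hy
        simpa [hσ] using hVU hy j)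
  refine le_iSup₂_of_le _ (dirac_const_mem_invariantProb Γ d y) ?_
  simp only [ProbabilityMeasure.coe_mk]
  rw [integral_dirac, ordAt_eq_card]
  have : (d : ℝ) + 1 ≤ ((𝒱.filter fun V => (fun _ : Γ => y) ∈ V).card : ℝ) := by
    exact_mod_cast hy
  have h2 : (d : ℝ) ≤ -1 + ((𝒱.filter fun V => (fun _ : Γ => y) ∈ V).card : ℝ) := by linarith
  exact_mod_cast EReal.coe_le_coe h2

end LowerBound

section CellCover

/-- The distance of a real number to the nearest integer. -/
noncomputable def distInt (t : ℝ) : ℝ := |t - round t|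

theorem continuous_distInt : Continuous distInt := by
  have h : distInt = fun t : ℝ => ‖(t : UnitAddCircle)‖ := by
    funext t
    rw [UnitAddCircle.norm_eq, distInt]
  rw [h]
  exact continuous_norm.comp (AddCircle.continuous_mk' 1)

theorem eq_of_abs_sub_intCast_lt {t r : ℝ} {m m' : ℤ} (hr : r ≤ 1 / 2) (h : |t - m| < r)
    (h' : |t - m'| < r) : m = m' := by
  have h1 : |((m - m' : ℤ) : ℝ)| < 1 := by
    rw [abs_lt] at h h' ⊢
    push_cast
    constructor <;> linarith [h.1, h.2, h'.1, h'.2]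
  have h2 : |m - m'| < 1 := by exact_mod_cast h1
  exact sub_eq_zero.1 (Int.abs_lt_one_iff.1 h2)

theorem eq_of_distInt_sub_div_lt {q e e' : ℕ} (he : e < q) (he' : e' < q) {t : ℝ}
    (h : distInt (t - e / q) < 1 / (2 * q)) (h' : distInt (t - e' / q) < 1 / (2 * q)) :
    e = e' := by
  have hq : (0 : ℝ) < q := by exact_mod_cast (Nat.zero_le e).trans_lt he
  have key : ∀ (e : ℕ) (a : ℤ), |t - e / q - a| < 1 / (2 * q) →
      |q * t - ((e + q * a : ℤ) : ℝ)| < 1 / 2 := by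
    intro e a h
    have h1 : q * t - ((e + q * a : ℤ) : ℝ) = q * (t - e / q - a) := by
      push_cast
      field_simp
      ring
    rw [h1, abs_mul, Nat.abs_cast]
    calc (q : ℝ) * |t - e / q - a| < q * (1 / (2 * q)) := by gcongr
      _ = 1 / 2 := by field_simp
  have h1 := eq_of_abs_sub_intCast_lt le_rfl (key e _ h) (key e' _ h')
  have h2 : (e : ℤ) % q = (e' : ℤ) % q := by
    have := congrArg (· % (q : ℤ)) h1
    simpa using this
  rw [Int.emod_eq_of_lt (by positivity) (by exact_mod_cast he),
    Int.emod_eq_of_lt (by positivity) (by exact_mod_cast he')] at h2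
  exact_mod_cast h2

variable {X ι : Type*}

/-- The set of points `x` for which `u i x` is near the integer `τ i` for `i ∈ S`, lies between
`τ i` and `τ i + 1` for `i ∉ S`, and is closer to the integers for `i ∈ S` than for `i ∉ S`. -/
def cell (u : ι → X → ℝ) (r : ℝ) (S : Finset ι) (τ : ι → ℤ) : Set X :=
  {x | (∀ i, i ∈ S → |u i x - τ i| < r) ∧ (∀ i, i ∉ S → (τ i : ℝ) < u i x ∧ u i x < τ i + 1) ∧
    ∀ i, i ∈ S → ∀ j, j ∉ S → distInt (u i x) < distInt (u j x)}

theorem abs_sub_lt_one_of_mem_cell {u : ι → X → ℝ} {r : ℝ} (hr : r ≤ 1 / 2) {S : Finset ι}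
    {τ : ι → ℤ} {x y : X} (hx : x ∈ cell u r S τ) (hy : y ∈ cell u r S τ) (i : ι) :
    |u i x - u i y| < 1 := by
  by_cases hi : i ∈ S
  · have h1 := abs_lt.1 (hx.1 i hi)
    have h2 := abs_lt.1 (hy.1 i hi)
    rw [abs_lt]
    constructor <;> linarith [h1.1, h1.2, h2.1, h2.2]
  · have h1 := hx.2.1 i hi
    have h2 := hy.2.1 i hi
    rw [abs_lt]
    constructor <;> linarith [h1.1, h1.2, h2.1, h2.2]

theorem subset_or_subset_of_mem_cell {u : ι → X → ℝ} {r : ℝ} {S S' : Finset ι} {τ τ' : ι → ℤ}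
    {x : X} (hx : x ∈ cell u r S τ) (hx' : x ∈ cell u r S' τ') : S ⊆ S' ∨ S' ⊆ S := by
  by_contra! h
  obtain ⟨i, hi, hi'⟩ := Finset.not_subset.1 h.1
  obtain ⟨j, hj', hj⟩ := Finset.not_subset.1 h.2
  exact lt_asymm (hx.2.2 i hi j hj) (hx'.2.2 j hj' i hi')

theorem eq_of_mem_cell {u : ι → X → ℝ} {r : ℝ} (hr : r ≤ 1 / 2) {S : Finset ι} {τ τ' : ι → ℤ}
    {x : X} (hx : x ∈ cell u r S τ) (hx' : x ∈ cell u r S τ') : τ = τ' := by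
  funext i
  by_cases hi : i ∈ S
  · exact eq_of_abs_sub_intCast_lt hr (hx.1 i hi) (hx'.1 i hi)
  · have h1 := hx.2.1 i hi
    have h2 := hx'.2.1 i hi
    rw [← Int.floor_eq_iff.2 ⟨h1.1.le, h1.2⟩, ← Int.floor_eq_iff.2 ⟨h2.1.le, h2.2⟩]

variable [Fintype ι]

theorem isOpen_cell [TopologicalSpace X] {u : ι → X → ℝ} (hu : ∀ i, Continuous (u i)) (r : ℝ)
    (S : Finset ι) (τ : ι → ℤ) : IsOpen (cell u r S τ) := by
  have hd : ∀ i, Continuous fun x => distInt (u i x) := fun i => continuous_distInt.comp (hu i)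
  simp only [cell, Set.ofPred_and, Set.ofPred_forall]
  refine .inter ?_ (.inter ?_ ?_)
  · exact isOpen_iInter_of_finite fun i => isOpen_iInter_of_finite fun _ =>
      isOpen_lt (((hu i).sub continuous_const).abs) continuous_const
  · exact isOpen_iInter_of_finite fun i => isOpen_iInter_of_finite fun _ =>
      (isOpen_lt continuous_const (hu i)).inter (isOpen_lt (hu i) continuous_const)
  · exact isOpen_iInter_of_finite fun i => isOpen_iInter_of_finite fun _ =>
      isOpen_iInter_of_finite fun j => isOpen_iInter_of_finite fun _ => isOpen_lt (hd i) (hd j)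

open Classical in
/-- The collection of all cells with the integers `τ i` in `K`. -/
noncomputable def cellCover (u : ι → X → ℝ) (r : ℝ) (K : Finset ℤ) : Finset (Set X) :=
  ((Finset.univ : Finset (Finset ι)) ×ˢ Fintype.piFinset fun _ => K).image
    fun p => cell u r p.1 p.2

theorem exists_of_mem_cellCover {u : ι → X → ℝ} {r : ℝ} {K : Finset ℤ} {V : Set X}
    (h : V ∈ cellCover u r K) : ∃ S τ, V = cell u r S τ := by
  classical
  obtain ⟨p, -, rfl⟩ := Finset.mem_image.1 h
  exact ⟨p.1, p.2, rfl⟩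

theorem isOpenCover_cellCover [TopologicalSpace X] {u : ι → X → ℝ} (hu : ∀ i, Continuous (u i))
    {r : ℝ} (hr : 0 < r) {K : Finset ℤ} (hK : ∀ i x, ∀ m : ℤ, |u i x - m| ≤ 1 → m ∈ K) :
    IsOpenCover (cellCover u r K) := by
  classical
  refine ⟨fun V hV => ?_, fun x => ?_⟩
  · obtain ⟨S, τ, rfl⟩ := exists_of_mem_cellCover hV
    exact isOpen_cell hu r S τ
  · let S : Finset ι := Finset.univ.filter fun i => distInt (u i x) = 0
    have hS : ∀ i, i ∈ S ↔ distInt (u i x) = 0 := fun i => by simp [S]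
    let τ : ι → ℤ := fun i => if i ∈ S then round (u i x) else ⌊u i x⌋
    refine ⟨cell u r S τ, Finset.mem_image.2 ⟨(S, τ), ?_, rfl⟩, ?_, ?_, ?_⟩
    · simp only [Finset.mem_product, Finset.mem_univ, true_and, Fintype.mem_piFinset]
      refine fun i => hK i x _ ?_
      by_cases hi : i ∈ S
      · simp only [τ, if_pos hi]
        exact (abs_sub_round _).trans (by norm_num)
      · simp only [τ, if_neg hi]
        rw [Int.self_sub_floor, abs_of_nonneg (Int.fract_nonneg (u i x))]
        exact (Int.fract_lt_one (u i x)).le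
    · intro i hi
      simp only [τ, if_pos hi]
      exact ((hS i).1 hi).trans_lt hr
    · intro i hi
      simp only [τ, if_neg hi]
      refine ⟨(Int.floor_le _).lt_of_ne fun h => hi ((hS i).2 ?_), Int.lt_floor_add_one _⟩
      rw [distInt, ← h]
      simp
    · intro i hi j hj
      rw [(hS i).1 hi]
      exact (abs_nonneg _).lt_of_ne fun h => hj ((hS j).2 h.symm)

theorem ordAt_cellCover_le (u : ι → X → ℝ) {r : ℝ} (hr : r ≤ 1 / 2) (K : Finset ℤ) (x : X) :
    ordAt (cellCover u r K) x ≤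
      ∑ i, {x | distInt (u i x) < r}.indicator (1 : X → ℝ) x := by
  classical
  set T : Finset ι := Finset.univ.filter fun i => distInt (u i x) < r with hT
  have hsum : ∑ i, {x | distInt (u i x) < r}.indicator (1 : X → ℝ) x = T.card := by
    rw [hT, Finset.card_filter]
    push_cast
    refine Finset.sum_congr rfl fun i _ => ?_
    simp [Set.indicator_apply]
  let P := ((Finset.univ : Finset (Finset ι)) ×ˢ Fintype.piFinset fun _ : ι => K).filter
    fun p => x ∈ cell u r p.1 p.2
  have h1 : ((cellCover u r K).filter fun V => x ∈ V) ⊆ P.image fun p => cell u r p.1 p.2 := by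
    intro V hV
    obtain ⟨hV, hx⟩ := Finset.mem_filter.1 hV
    obtain ⟨p, hp, rfl⟩ := Finset.mem_image.1 hV
    exact Finset.mem_image.2 ⟨p, Finset.mem_filter.2 ⟨hp, hx⟩, rfl⟩
  have h2 : P.card ≤ (Finset.range (T.card + 1)).card := by
    refine Finset.card_le_card_of_injOn (fun p => p.1.card) ?_ ?_
    · intro p hp
      have hx := (Finset.mem_filter.1 (Finset.mem_coe.1 hp)).2
      refine Finset.mem_coe.2 (Finset.mem_range.2 (Nat.lt_succ_iff.2 (Finset.card_le_card ?_)))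
      intro i hi
      simp only [hT, Finset.mem_filter, Finset.mem_univ, true_and]
      exact (round_le _ _).trans_lt (hx.1 i hi)
    · rintro ⟨S, τ⟩ hp ⟨S', τ'⟩ hp' hcard
      have hx := (Finset.mem_filter.1 (Finset.mem_coe.1 hp)).2
      have hx' := (Finset.mem_filter.1 (Finset.mem_coe.1 hp')).2
      obtain rfl : S = S' := by
        rcases subset_or_subset_of_mem_cell hx hx' with h | h
        · exact Finset.eq_of_subset_of_card_le h hcard.ge
        · exact (Finset.eq_of_subset_of_card_le h hcard.le).symm
      exact Prod.ext rfl (eq_of_mem_cell hr hx hx')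
  have h3 : ((cellCover u r K).filter fun V => x ∈ V).card ≤ T.card + 1 :=
    (Finset.card_le_card h1).trans (Finset.card_image_le.trans (h2.trans (by simp)))
  have h4 : (((cellCover u r K).filter fun V => x ∈ V).card : ℝ) ≤ T.card + 1 := by
    exact_mod_cast h3
  rw [hsum, ordAt_eq_card]
  linarith

end CellCover

section UpperBound

/-- A Lebesgue number for open covers of an infinite product of compact metric spaces. -/
theorem exists_lebesgue_number_pi {Γ K : Type*} [Nonempty Γ] [PseudoMetricSpace K] [CompactSpace K]
    [Nonempty K] {𝒰 : Finset (Set (Γ → K))} (h𝒰 : IsOpenCover 𝒰) :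
    ∃ (F : Finset Γ) (M : ℕ), F.Nonempty ∧ 0 < M ∧ ∀ W : Set (Γ → K),
      (∀ x ∈ W, ∀ y ∈ W, ∀ γ ∈ F, dist (x γ) (y γ) ≤ 1 / M) → ∃ U ∈ 𝒰, W ⊆ U := by
  classical
  obtain ⟨N, hN, hball⟩ := lebesgue_number_lemma_sUnion (S := (𝒰 : Set (Set (Γ → K))))
    isCompact_univ h𝒰.1 (fun x _ => h𝒰.2 x)
  rw [Pi.uniformity, (Filter.HasBasis.iInf' fun γ =>
    Metric.uniformity_basis_dist.comap fun a : (Γ → K) × (Γ → K) => (a.1 γ, a.2 γ)).mem_iff] at hN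
  obtain ⟨⟨I, ε⟩, ⟨hI, hε⟩, hIN⟩ := hN
  have hM : ∀ᶠ M : ℕ in Filter.atTop, ∀ γ ∈ I, (1 : ℝ) / M < ε γ :=
    (Filter.eventually_all_finite hI).2 fun γ hγ =>
      (tendsto_one_div_atTop_nhds_zero_nat (𝕜 := ℝ)).eventually_lt_const (hε γ hγ)
  obtain ⟨M, hM, hMpos⟩ := (hM.and (Filter.eventually_gt_atTop 0)).exists
  refine ⟨insert (Classical.arbitrary Γ) hI.toFinset, M, Finset.insert_nonempty _ _, hMpos,
    fun W hW => ?_⟩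
  rcases W.eq_empty_or_nonempty with rfl | ⟨x, hx⟩
  · obtain ⟨U, hU, -⟩ := h𝒰.2 (Classical.arbitrary _)
    exact ⟨U, hU, Set.empty_subset _⟩
  · obtain ⟨U, hU, hxU⟩ := hball x (Set.mem_univ _)
    refine ⟨U, hU, fun y hy => hxU (hIN ?_)⟩
    simp only [Set.mem_iInter]
    intro γ hγ
    exact (hW x hx y hy γ (Finset.mem_insert_of_mem (hI.mem_toFinset.2 hγ))).trans_lt (hM γ hγ)

theorem integrable_ordAt {X : Type*} [TopologicalSpace X] [MeasurableSpace X] [BorelSpace X]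
    {𝒱 : Finset (Set X)} (h𝒱 : IsOpenCover 𝒱) (μ : Measure X) [IsFiniteMeasure μ] :
    Integrable (ordAt 𝒱) μ :=
  (integrable_const _).add (integrable_finsetSum _ fun V hV =>
    (integrable_const (1 : ℝ)).indicator (h𝒱.1 V hV).measurableSet)

variable {Γ : Type*} {d : ℕ}

/-- The coordinate `x γ j` rescaled by `M` and translated by a multiple of `1 / #F` depending
on `γ ∈ F`. -/
noncomputable def rescaledCoord (F : Finset Γ) (M : ℕ) (i : F × Fin d)
    (x : Γ → Fin d → unitInterval) : ℝ :=
  M * (x i.1 i.2 : ℝ) - (F.equivFin i.1 : ℕ) / F.card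

theorem continuous_rescaledCoord (F : Finset Γ) (M : ℕ) (i : F × Fin d) :
    Continuous (rescaledCoord F M i) := by
  unfold rescaledCoord
  fun_prop

theorem mem_Icc_of_abs_rescaledCoord_sub_le {F : Finset Γ} {M : ℕ} {i : F × Fin d}
    {x : Γ → Fin d → unitInterval} {m : ℤ} (h : |rescaledCoord F M i x - m| ≤ 1) :
    m ∈ Finset.Icc (-2 : ℤ) (M + 1) := by
  have h0 := (x i.1 i.2).2.1
  have h1 := (x i.1 i.2).2.2
  have he : ((F.equivFin i.1 : ℕ) : ℝ) / F.card ≤ 1 := by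
    apply div_le_one_of_le₀ _ (by positivity)
    exact_mod_cast (F.equivFin i.1).2.le
  have he0 : (0 : ℝ) ≤ ((F.equivFin i.1 : ℕ) : ℝ) / F.card := by positivity
  have hM0 : (0 : ℝ) ≤ M * (x i.1 i.2 : ℝ) := by positivity
  have hM1 : (M : ℝ) * (x i.1 i.2 : ℝ) ≤ M := mul_le_of_le_one_right (by positivity) h1
  rw [rescaledCoord, abs_le] at h
  rw [Finset.mem_Icc]
  constructor
  · have : (-2 : ℝ) ≤ m := by linarith [h.2]
    exact_mod_cast this
  · have : (m : ℝ) ≤ M + 1 := by linarith [h.1]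
    exact_mod_cast this

theorem dist_le_of_abs_rescaledCoord_sub_lt {F : Finset Γ} {M : ℕ} (hM : 0 < M)
    {x y : Γ → Fin d → unitInterval}
    (h : ∀ i : F × Fin d, |rescaledCoord F M i x - rescaledCoord F M i y| < 1) {γ : Γ}
    (hγ : γ ∈ F) : dist (x γ) (y γ) ≤ 1 / M := by
  have hM' : (0 : ℝ) < M := by exact_mod_cast hM
  refine (dist_pi_le_iff (by positivity)).2 fun j => ?_
  rw [Subtype.dist_eq, Real.dist_eq, le_div_iff₀ hM', mul_comm, ← Nat.abs_cast, ← abs_mul]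
  have := (h (⟨γ, hγ⟩, j)).le
  simp only [rescaledCoord, sub_sub_sub_cancel_right, ← mul_sub] at this
  exact this

variable [Group Γ] [Countable Γ]

theorem sum_measureReal_distInt_lt_le (F : Finset Γ) (M : ℕ)
    {μ : ProbabilityMeasure (Γ → Fin d → unitInterval)}
    (hμ : μ ∈ invariantProb (shift Γ (Fin d → unitInterval))) :
    ∑ i : F × Fin d, (μ : Measure (Γ → Fin d → unitInterval)).real
      {x | distInt (rescaledCoord F M i x) < 1 / (2 * F.card)} ≤ d := by
  let D : F → Fin d → Set (Γ → Fin d → unitInterval) := fun γ j =>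
    {x | distInt (M * (x 1 j : ℝ) - (F.equivFin γ : ℕ) / F.card) < 1 / (2 * F.card)}
  have hD : ∀ γ j, MeasurableSet (D γ j) := fun γ j =>
    (isOpen_lt (continuous_distInt.comp (by fun_prop)) continuous_const).measurableSet
  have hshift : ∀ i : F × Fin d, (μ : Measure (Γ → Fin d → unitInterval)).real
      {x | distInt (rescaledCoord F M i x) < 1 / (2 * F.card)} =
        (μ : Measure (Γ → Fin d → unitInterval)).real (D i.1 i.2) := by
    intro i
    conv_rhs => rw [← hμ (i.1 : Γ)⁻¹]
    rw [map_measureReal_apply (shift Γ _ _).continuous.measurable (hD _ _)]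
    congr 1
    ext x
    simp [D, rescaledCoord, shift]
  have hdisj : ∀ j, ∑ γ, (μ : Measure (Γ → Fin d → unitInterval)).real (D γ j) ≤ 1 := by
    intro j
    refine (sum_measureReal_le_measureReal_univ (fun γ _ => hD γ j) ?_).trans (by simp)
    intro γ _ γ' _ hne
    refine Set.disjoint_left.2 fun x hx hx' => hne (F.equivFin.injective (Fin.ext ?_))
    exact eq_of_distInt_sub_div_lt (F.equivFin γ).2 (F.equivFin γ').2 hx hx'
  calc _ = ∑ i : F × Fin d, (μ : Measure (Γ → Fin d → unitInterval)).real (D i.1 i.2) :=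
        Finset.sum_congr rfl fun i _ => hshift i
    _ = ∑ j, ∑ γ, (μ : Measure (Γ → Fin d → unitInterval)).real (D γ j) :=
        Fintype.sum_prod_type_right _
    _ ≤ ∑ _j : Fin d, (1 : ℝ) := Finset.sum_le_sum fun j _ => hdisj j
    _ = d := by simp

variable (Γ d)

theorem dimSystem_shift_le : dimSystem (shift Γ (Fin d → unitInterval)) ≤ d := by
  refine iSup₂_le fun 𝒰 h𝒰 => ?_
  obtain ⟨F, M, hF, hM, hFM⟩ := exists_lebesgue_number_pi h𝒰
  have hq : (1 : ℝ) ≤ F.card := by exact_mod_cast hF.card_pos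
  have hr : (1 : ℝ) / (2 * F.card) ≤ 1 / 2 := by
    apply one_div_le_one_div_of_le <;> linarith
  have hr0 : (0 : ℝ) < 1 / (2 * F.card) := by positivity
  have hcover := isOpenCover_cellCover (continuous_rescaledCoord (d := d) F M) hr0
    (K := Finset.Icc (-2 : ℤ) (M + 1)) fun i x m h => mem_Icc_of_abs_rescaledCoord_sub_le h
  refine iInf₂_le_of_le _ ⟨hcover, fun V hV => ?_⟩ (iSup₂_le fun μ hμ => ?_)
  · obtain ⟨S, τ, rfl⟩ := exists_of_mem_cellCover hV
    exact hFM _ fun x hx y hy γ hγ => dist_le_of_abs_rescaledCoord_sub_lt hM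
      (fun i => abs_sub_lt_one_of_mem_cell hr hx hy i) hγ
  · have hmeas : ∀ i : F × Fin d,
        MeasurableSet {x | distInt (rescaledCoord F M i x) < 1 / (2 * F.card)} := fun i =>
      (isOpen_lt (continuous_distInt.comp (continuous_rescaledCoord F M i))
        continuous_const).measurableSet
    have hint : ∀ i : F × Fin d,
        Integrable ({x | distInt (rescaledCoord F M i x) < 1 / (2 * F.card)}.indicator
          (1 : (Γ → Fin d → unitInterval) → ℝ)) (μ : Measure (Γ → Fin d → unitInterval)) :=
      fun i => (integrable_const (1 : ℝ)).indicator (hmeas i)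
    have h := integral_mono (integrable_ordAt hcover μ)
      (integrable_finsetSum Finset.univ fun i _ => hint i) (ordAt_cellCover_le _ hr _)
    rw [integral_finsetSum _ fun i _ => hint i] at h
    simp only [integral_indicator_one (hmeas _)] at h
    exact_mod_cast EReal.coe_le_coe (h.trans (sum_measureReal_distInt_lt_le F M hμ))

end UpperBound

end CubicalShift

theorem theorem8p1 (Γ : Type*) [Group Γ] [Countable Γ] (d : ℕ) :
    CubicalShift.dimSystem (CubicalShift.shift Γ (Fin d → unitInterval)) = (d : EReal) :=
  le_antisymm (CubicalShift.dimSystem_shift_le Γ d) (CubicalShift.le_dimSystem_shift Γ d)
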